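/- Consider the triangular lattice $\mathbb{T}^2$ in the plane. A \emph{polyiamond} is a nonempty finite set $P$ of (triangular) faces of $\mathbb{T}^2$ that is connected through shared edges. Its area $\|P\|$ is the number of its faces, and its edge-perimeter $p(P)$ is the number of unit edges of $\mathbb{T}^2$ that separate a face in $P$ from a face not in $P$. A \emph{bar} with larger base $l \ge 1$ is the set of $2l-1$ faces obtained from an equilateral lattice triangle of side $l$ by removing the equilateral lattice triangle of side $l-1$ at one of its corners. For an integer $r \ge 1$ let $E(r) = E_{B_0}(r)$ be the regular hexagon of side length $r$ with vertices in the lattice. Going around $E(r)$, attach bars successively along their larger bases to consecutive sides: $E_{B_1}(r)$ is $E(r)$ with a bar of larger base $r$ attached to a side; for $i = 2,\dots,5$, $E_{B_i}(r)$ is $E_{B_{i-1}}(r)$ with a bar of larger base $r+1$ attached to the next side (of length $r+1$); and $E_{B_6}(r) = E(r+1)$ is $E_{B_5}(r)$ with a bar of larger base $r+2$ attached to the last side. A \emph{quasi-regular hexagon} is any set of faces obtained from some $E_{B_i}(r)$, $r \ge 1$, $0 \le i \le 6$, by a lattice translation and a rotation by a multiple of $\pi/3$. \textbf{Lemma.}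 Let $\bar p$ be the edge-perimeter of a quasi-regular hexagon and let $\bar A$ be its area. Then every polyiamond $P$ with $\|P\| = \bar A$ that is not a quasi-regular hexagon satisfies $p(P) \ge \bar p + 2$. -/

import Mathlib

namespace Polyiamond

/-- A vertex of the triangular lattice: `(x, y)` stands for the point `x • e₁ + y • e₂` of the plane,
where `e₁`, `e₂` are unit vectors at angle `π / 3`. -/
abbrev Vertex : Type := ℤ × ℤ

/-- A face (unit triangle) of the triangular lattice.
`⟨x, y, false⟩` is the triangle with vertices `(x, y)`, `(x + 1, y)`, `(x, y + 1)`, and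
`⟨x, y, true⟩` is the triangle with vertices `(x + 1, y)`, `(x, y + 1)`, `(x + 1, y + 1)`. -/
@[ext] structure Face where
  x : ℤ
  y : ℤ
  down : Bool
deriving DecidableEq

/-- The three vertices of a face. -/
def Face.vertices : Face → Finset Vertex
  | ⟨x, y, false⟩ => {(x, y), (x + 1, y), (x, y + 1)}
  | ⟨x, y, true⟩ => {(x + 1, y), (x, y + 1), (x + 1, y + 1)}

/-- The three edges of a face; an edge of the lattice is given by its pair of end points. -/
def Face.edges (f : Face) : Finset (Finset Vertex) := f.vertices.powersetCard 2

/-- Two distinct faces are adjacent when they share an edge (a common vertex is not enough). -/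
def faceGraph : SimpleGraph Face where
  Adj f g := f ≠ g ∧ ∃ e, e ∈ f.edges ∧ e ∈ g.edges
  symm := ⟨fun _ _ h => ⟨h.1.symm, h.2.imp fun _ he => ⟨he.2, he.1⟩⟩⟩
  loopless := ⟨fun _ h => h.1 rfl⟩

/-- A polyiamond: a finite nonempty edge-connected set of faces. -/
def IsPolyiamond (P : Finset Face) : Prop :=
  (faceGraph.induce (P : Set Face)).Connected

/-- The area: the number of triangular units. -/
def area (P : Finset Face) : ℕ := P.card

/-- The boundary: the edges separating a triangular unit of `P` from an empty triangular unit. -/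
def boundary (P : Finset Face) : Set (Finset Vertex) :=
  {e | ∃ f ∈ P, ∃ g ∉ P, e ∈ f.edges ∧ e ∈ g.edges}

theorem boundary_finite (P : Finset Face) : (boundary P).Finite :=
  (P.biUnion Face.edges).finite_toSet.subset fun _ ⟨f, hf, _, _, he, _⟩ =>
    Finset.mem_coe.2 (Finset.mem_biUnion.2 ⟨f, hf, he⟩)

/-- The edge-perimeter: the number of boundary edges. -/
noncomputable def edgePerimeter (P : Finset Face) : ℕ := (boundary P).ncard

/-- The face lies in the strip `f.row ≤ x + y ≤ f.row + 1`, where `(x, y)` are the coordinates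
with respect to `e₁`, `e₂`. (It also lies in the strips `f.x ≤ x ≤ f.x + 1` and
`f.y ≤ y ≤ f.y + 1`.) -/
def Face.row (f : Face) : ℤ := f.x + f.y + if f.down then 1 else 0

/-- The equilateral triangle of side `l` with vertices `(p, q)`, `(p + l, q)`, `(p, q + l)`. -/
def upTriangle (p q : ℤ) (l : ℕ) : Set Face :=
  {f | p ≤ f.x ∧ q ≤ f.y ∧ f.row < p + q + l}

/-- The equilateral triangle of side `l` with vertices `(p, q)`, `(p - l, q)`, `(p, q - l)`. -/
def downTriangle (p q : ℤ) (l : ℕ) : Set Face :=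
  {f | f.x < p ∧ f.y < q ∧ p + q - l ≤ f.row}

/-- The regular hexagon `E(r)` of radius (side length) `r` centred at the vertex `(0, 0)`. -/
def regularHexagon (r : ℕ) : Set Face :=
  {f | -(r : ℤ) ≤ f.x ∧ f.x < r ∧ -(r : ℤ) ≤ f.y ∧ f.y < r ∧ -(r : ℤ) ≤ f.row ∧ f.row < r}

/-- The bars attached one after the other, going around the hexagon `E(r)`; `bar r i` is the
`(i + 1)`-st bar. Each is the difference of an equilateral triangle of side `l` and one of side
`l - 1` with a common corner, where `l = r` for the first bar, `l = r + 1` for the next four and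
`l = r + 2` for the last; its larger base is a full side (of length `l`) of the hexagon obtained
before. -/
def bar (r : ℕ) : ℕ → Set Face
  | 0 => downTriangle r r r \ downTriangle r r (r - 1)
  | 1 => upTriangle (-r) r (r + 1) \ upTriangle (-r) (r + 1) r
  | 2 => downTriangle (-r) (r + 1) (r + 1) \ downTriangle (-r - 1) (r + 1) r
  | 3 => upTriangle (-r - 1) (-r) (r + 1) \ upTriangle (-r - 1) (-r) r
  | 4 => downTriangle r (-r) (r + 1) \ downTriangle r (-r - 1) r
  | 5 => upTriangle r (-r - 1) (r + 2) \ upTriangle (r + 1) (-r - 1) (r + 1)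
  | _ => ∅

/-- The hexagon `E_{B_i}(r)` in a fixed position: `E(r)` with the first `i` bars attached.
In particular `hexagonWithBars r 6` is `E(r + 1)`. -/
def hexagonWithBars (r : ℕ) : ℕ → Set Face
  | 0 => regularHexagon r
  | i + 1 => hexagonWithBars r i ∪ bar r i

/-- The translation by the lattice vector `v`. -/
def translateFace (v : Vertex) (f : Face) : Face := ⟨f.x + v.1, f.y + v.2, f.down⟩

/-- The rotation by `π / 3` about the vertex `(0, 0)`, which sends `e₁` to `e₂` and `e₂` to
`e₂ - e₁`. -/
def rotateFace : Face → Face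
  | ⟨x, y, false⟩ => ⟨-y - 1, x + y, true⟩
  | ⟨x, y, true⟩ => ⟨-y - 1, x + y + 1, false⟩

/-- A quasi-regular hexagon: a translate of a rotation by a multiple of `π / 3` of some
`E_{B_i}(r)`, `r ≥ 1`, `0 ≤ i ≤ 6`. -/
def IsQuasiRegularHexagon (P : Finset Face) : Prop :=
  ∃ r i z : ℕ, ∃ v : Vertex, 1 ≤ r ∧ i ≤ 6 ∧
    (P : Set Face) = (fun f => translateFace v (rotateFace^[z] f)) '' hexagonWithBars r i

/-- On vertices, `rotateFace` is the linear map `(x, y) ↦ (-y, x + y)`. -/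
theorem vertices_rotateFace (f : Face) :
    (rotateFace f).vertices = f.vertices.image fun w => (-w.2, w.1 + w.2) := by
  rcases f with ⟨x, y, _ | _⟩ <;> ext ⟨a, b⟩ <;>
    simp only [rotateFace, Face.vertices, Finset.image_insert, Finset.image_singleton,
      Finset.mem_insert, Finset.mem_singleton, Prod.mk.injEq] <;> omega

/-- On vertices, `translateFace v` is `w ↦ w + v`. -/
theorem vertices_translateFace (v : Vertex) (f : Face) :
    (translateFace v f).vertices = f.vertices.image fun w => w + v := by
  rcases f with ⟨x, y, _ | _⟩ <;> ext ⟨a, b⟩ <;>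
    simp only [translateFace, Face.vertices, Finset.image_insert, Finset.image_singleton,
      Finset.mem_insert, Finset.mem_singleton, Prod.ext_iff, Prod.fst_add,
      Prod.snd_add] <;> omega

end Polyiamond

/-! Each face lies in one strip of each of the three directions, recorded by `x`, `y` and `row`.
Every strip meeting a finite set `P` is left at both of its ends, and every boundary edge is crossed
by strips of exactly two directions; so `p(P)` is at least the number of strips met
(`card_images_le_edgePerimeter`). Connectedness makes the strips met in each direction consecutive,
so `P` lies in a lattice hexagon whose perimeter is at most `p(P)` (`IsPolyiamond.exists_bounds`).

For a lattice hexagon, `6 * area = perim ^ 2 - deficit`, where `deficit` is a weighted sum of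
squares measuring irregularity (`Valid.six_mul_card_faces`). It is at most `7` for quasi-regular
hexagons, and conversely (`isQuasiRegularHexagon_of_deficit_le`).

Area and perimeter have the same parity, so a counterexample `P` has perimeter at most `p̄`. Its
hexagon cannot have perimeter below `p̄`, since the area would be too small. With perimeter exactly
`p̄` its area exceeds that of `P` by at most one, hence by zero for parity reasons. So `P` is that
hexagon, its deficit is at most `7`, and it is quasi-regular. -/

namespace Polyiamond

open Finset

/-! ### Faces, edges and neighbours -/

/-- The face on the other side of an edge of `f`: the neighbour `neighbor d f` differs from `f` in
exactly one of the three strip coordinates `x`, `y`, `row`, which is singled out by `d`. -/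
def neighbor : Fin 3 → Face → Face
  | 0, ⟨x, y, false⟩ => ⟨x - 1, y, true⟩
  | 0, ⟨x, y, true⟩ => ⟨x + 1, y, false⟩
  | 1, ⟨x, y, false⟩ => ⟨x, y - 1, true⟩
  | 1, ⟨x, y, true⟩ => ⟨x, y + 1, false⟩
  | 2, ⟨x, y, b⟩ => ⟨x, y, !b⟩

/-- The edge shared by `f` and `neighbor d f`. -/
def sharedEdge : Fin 3 → Face → Finset Vertex
  | 0, ⟨x, y, false⟩ => {(x, y), (x, y + 1)}
  | 0, ⟨x, y, true⟩ => {(x + 1, y), (x + 1, y + 1)}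
  | 1, ⟨x, y, false⟩ => {(x, y), (x + 1, y)}
  | 1, ⟨x, y, true⟩ => {(x, y + 1), (x + 1, y + 1)}
  | 2, ⟨x, y, _⟩ => {(x + 1, y), (x, y + 1)}

@[simp] theorem row_false (x y : ℤ) : Face.row ⟨x, y, false⟩ = x + y := by simp [Face.row]

@[simp] theorem row_true (x y : ℤ) : Face.row ⟨x, y, true⟩ = x + y + 1 := by simp [Face.row]

theorem neighbor_neighbor (d : Fin 3) (f : Face) : neighbor d (neighbor d f) = f := by
  rcases f with ⟨x, y, _ | _⟩ <;> fin_cases d <;> simp [neighbor]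

theorem neighbor_ne (d : Fin 3) (f : Face) : neighbor d f ≠ f := by
  rcases f with ⟨x, y, _ | _⟩ <;> fin_cases d <;> simp [neighbor]

theorem sharedEdge_neighbor (d : Fin 3) (f : Face) :
    sharedEdge d (neighbor d f) = sharedEdge d f := by
  rcases f with ⟨x, y, _ | _⟩ <;> fin_cases d <;> simp [neighbor, sharedEdge]

theorem powersetCard_two_triple {α : Type*} [DecidableEq α] {a b c : α} (hab : a ≠ b)
    (hac : a ≠ c) (hbc : b ≠ c) (e : Finset α) :
    e ∈ powersetCard 2 {a, b, c} ↔ e = {a, b} ∨ e = {a, c} ∨ e = {b, c} := by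
  rw [mem_powersetCard]
  constructor
  · rintro ⟨hs, hc⟩
    obtain ⟨u, v, huv, rfl⟩ := card_eq_two.1 hc
    have hu := hs (mem_insert_self u {v})
    have hv := hs (mem_insert_of_mem (mem_singleton_self v))
    simp only [mem_insert, mem_singleton] at hu hv
    rcases hu with rfl | rfl | rfl <;> rcases hv with rfl | rfl | rfl <;>
      simp_all [pair_comm]
  · rintro (rfl | rfl | rfl)
    · exact ⟨by intro; simp; tauto, card_pair hab⟩
    · exact ⟨by intro; simp; tauto, card_pair hac⟩
    · exact ⟨by intro; simp; tauto, card_pair hbc⟩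

theorem mem_edges (f : Face) (e : Finset Vertex) : e ∈ f.edges ↔ ∃ d, e = sharedEdge d f := by
  rw [Fin.exists_fin_succ, Fin.exists_fin_two]
  rcases f with ⟨x, y, _ | _⟩
  · have := powersetCard_two_triple (a := (x, y)) (b := (x + 1, y)) (c := (x, y + 1))
      (by simp) (by simp) (by simp) e
    simp only [Face.edges, Face.vertices, this]
    simp only [sharedEdge, Fin.succ_zero_eq_one, Fin.succ_one_eq_two]
    tauto
  · have := powersetCard_two_triple (a := (x + 1, y)) (b := (x, y + 1)) (c := (x + 1, y + 1))
      (by simp) (by simp) (by simp) e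
    simp only [Face.edges, Face.vertices, this]
    simp only [sharedEdge, Fin.succ_zero_eq_one, Fin.succ_one_eq_two]
    tauto

/-- An edge of a given face determines its type and the pair of faces it separates. -/
theorem sharedEdge_eq_iff {d d' : Fin 3} {f g : Face} :
    sharedEdge d f = sharedEdge d' g ↔ d = d' ∧ (g = f ∨ g = neighbor d f) := by
  constructor
  · intro h
    -- The coordinate sums give twice the midpoint of the edge; their parities determine the
    -- direction, their values the edge.
    have h1 := congrArg (fun e : Finset Vertex => ∑ v ∈ e, v.1) h
    have h2 := congrArg (fun e : Finset Vertex => ∑ v ∈ e, v.2) h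
    rcases f with ⟨x, y, _ | _⟩ <;> rcases g with ⟨x', y', _ | _⟩ <;> fin_cases d <;>
      fin_cases d' <;>
      simp [sharedEdge, neighbor] at h1 h2 ⊢ <;> omega
  · rintro ⟨rfl, rfl | rfl⟩
    · rfl
    · exact (sharedEdge_neighbor d f).symm

theorem exists_neighbor_of_adj {f g : Face} (h : faceGraph.Adj f g) : ∃ d, g = neighbor d f := by
  obtain ⟨hne, e, hf, hg⟩ := h
  obtain ⟨d, rfl⟩ := (mem_edges f e).1 hf
  obtain ⟨d', h'⟩ := (mem_edges g _).1 hg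
  obtain ⟨-, h | h⟩ := sharedEdge_eq_iff.1 h'
  · exact absurd h.symm hne
  · exact ⟨d, h⟩

/-! ### The perimeter as a number of exits -/

/-- The faces of `P` at which the step `s` leaves `P`. -/
def exits (s : Face → Face) (P : Finset Face) : Finset Face := {f ∈ P | s f ∉ P}

theorem mem_exits {s : Face → Face} {P : Finset Face} {f : Face} :
    f ∈ exits s P ↔ f ∈ P ∧ s f ∉ P := mem_filter

theorem edgePerimeter_eq_sum (P : Finset Face) :
    edgePerimeter P = ∑ d, #(exits (neighbor d) P) := by
  have hb : boundary P =
      ((univ.sigma fun d => exits (neighbor d) P).image fun a => sharedEdge a.1 a.2 :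
        Finset (Finset Vertex)) := by
    ext e
    simp only [boundary, coe_image, Set.mem_ofPred_eq, Set.mem_image, mem_coe, mem_sigma,
      mem_univ, true_and, Sigma.exists, mem_exits]
    constructor
    · rintro ⟨f, hf, g, hg, hef, heg⟩
      obtain ⟨d, rfl⟩ := (mem_edges f e).1 hef
      obtain ⟨d', h'⟩ := (mem_edges g _).1 heg
      obtain ⟨-, rfl | rfl⟩ := sharedEdge_eq_iff.1 h'
      · exact absurd hf hg
      · exact ⟨d, f, ⟨hf, hg⟩, rfl⟩
    · rintro ⟨d, f, ⟨hf, hg⟩, rfl⟩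
      exact ⟨f, hf, _, hg, (mem_edges _ _).2 ⟨d, rfl⟩,
        (mem_edges _ _).2 ⟨d, (sharedEdge_neighbor d f).symm⟩⟩
  rw [edgePerimeter, hb, Set.ncard_coe_finset, card_image_of_injOn, card_sigma]
  rintro ⟨d, f⟩ hf ⟨d', g⟩ hg h
  obtain ⟨h1, h2⟩ := sharedEdge_eq_iff.1 h
  dsimp only at h1 h2
  subst h1
  rcases h2 with rfl | rfl
  · rfl
  · simp only [coe_sigma, Set.mem_sigma_iff, mem_coe, mem_exits] at hf hg
    exact absurd hg.2.1 hf.2.2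

/-- `neighbor d` is an involution without fixed points, so the faces of `P` whose `d`-neighbour is
also in `P` come in pairs. -/
theorem card_exits_neighbor_mod_two (d : Fin 3) (P : Finset Face) :
    #(exits (neighbor d) P) % 2 = #P % 2 := by
  have h1 : #{f ∈ P | neighbor d f ∈ P} % 2 = 0 := by
    have h : (#{f ∈ P | neighbor d f ∈ P} : ZMod 2) = 0 := by
      rw [card_eq_sum_ones, Nat.cast_sum]
      refine sum_involution (fun f _ => neighbor d f) (fun _ _ => by decide)
        (fun f _ _ => neighbor_ne d f) (fun f hf => ?_) fun f _ => neighbor_neighbor d f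
      rw [mem_filter] at hf ⊢
      exact ⟨hf.2, by rw [neighbor_neighbor]; exact hf.1⟩
    exact Nat.even_iff.1 ((ZMod.natCast_eq_zero_iff_even).1 h)
  have h2 := card_filter_add_card_filter_not (s := P) (fun f => neighbor d f ∈ P)
  change #{f ∈ P | neighbor d f ∈ P} + #(exits (neighbor d) P) = #P at h2
  omega

theorem edgePerimeter_mod_two (P : Finset Face) : edgePerimeter P % 2 = area P % 2 := by
  have h0 := card_exits_neighbor_mod_two 0 P
  have h1 := card_exits_neighbor_mod_two 1 P
  have h2 := card_exits_neighbor_mod_two 2 P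
  rw [edgePerimeter_eq_sum, Fin.sum_univ_three, area]
  omega

/-- One step along the strip perpendicular to the two directions `d` and `d'`. -/
def stripStep (d d' : Fin 3) (f : Face) : Face :=
  if f.down then neighbor d' f else neighbor d f

/-- The two orientations of a strip together cross, from each face, its `d`-edge once and its
`d'`-edge once. -/
theorem card_exits_stripStep (d d' : Fin 3) (P : Finset Face) :
    #(exits (stripStep d d') P) + #(exits (stripStep d' d) P) =
      #(exits (neighbor d) P) + #(exits (neighbor d') P) := by
  simp only [exits, card_filter, ← sum_add_distrib]
  refine sum_congr rfl fun f _ => ?_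
  rcases f with ⟨x, y, _ | _⟩
  · simp [stripStep]
  · simp [stripStep, add_comm]

/-- The factor `2` appears because each direction `d` belongs to two of the three pairs of
directions. -/
theorem two_mul_edgePerimeter (P : Finset Face) : 2 * edgePerimeter P =
    (#(exits (stripStep 2 1) P) + #(exits (stripStep 1 2) P)) +
    (#(exits (stripStep 2 0) P) + #(exits (stripStep 0 2) P)) +
    (#(exits (stripStep 1 0) P) + #(exits (stripStep 0 1) P)) := by
  simp only [card_exits_stripStep, edgePerimeter_eq_sum, Fin.sum_univ_three]
  ring

/-- In each strip (a level set of `c`) that meets `P`, the face of `P` furthest along `pos` is an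
exit. -/
theorem card_image_le_card_exits {P : Finset Face} {s : Face → Face} {c pos : Face → ℤ}
    (hc : ∀ f, c (s f) = c f) (hpos : ∀ f, pos f < pos (s f)) :
    #(P.image c) ≤ #(exits s P) := by
  refine (card_le_card ?_).trans (card_image_le (s := exits s P) (f := c))
  intro k hk
  obtain ⟨f, hf, rfl⟩ := mem_image.1 hk
  obtain ⟨g, hg, hmax⟩ := exists_max_image {g ∈ P | c g = c f} pos ⟨f, by simp [hf]⟩
  rw [mem_filter] at hg
  refine mem_image.2 ⟨g, mem_exits.2 ⟨hg.1, fun h => ?_⟩, hg.2⟩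
  exact absurd (hmax (s g) (mem_filter.2 ⟨h, (hc g).trans hg.2⟩)) (not_le.2 (hpos g))

theorem card_images_le_edgePerimeter (P : Finset Face) :
    #(P.image Face.x) + #(P.image Face.y) + #(P.image Face.row) ≤ edgePerimeter P := by
  have h1 : #(P.image Face.x) ≤ #(exits (stripStep 2 1) P) := by
    refine card_image_le_card_exits (pos := fun f => f.y + f.row) ?_ ?_ <;>
      rintro ⟨x, y, _ | _⟩ <;> simp [stripStep, neighbor] <;> omega
  have h2 : #(P.image Face.x) ≤ #(exits (stripStep 1 2) P) := by
    refine card_image_le_card_exits (pos := fun f => -(f.y + f.row)) ?_ ?_ <;>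
      rintro ⟨x, y, _ | _⟩ <;> simp [stripStep, neighbor] <;> omega
  have h3 : #(P.image Face.y) ≤ #(exits (stripStep 2 0) P) := by
    refine card_image_le_card_exits (pos := fun f => f.x + f.row) ?_ ?_ <;>
      rintro ⟨x, y, _ | _⟩ <;> simp [stripStep, neighbor] <;> omega
  have h4 : #(P.image Face.y) ≤ #(exits (stripStep 0 2) P) := by
    refine card_image_le_card_exits (pos := fun f => -(f.x + f.row)) ?_ ?_ <;>
      rintro ⟨x, y, _ | _⟩ <;> simp [stripStep, neighbor] <;> omega
  have h5 : #(P.image Face.row) ≤ #(exits (stripStep 1 0) P) := by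
    refine card_image_le_card_exits (pos := fun f => f.x - f.y) ?_ ?_ <;>
      rintro ⟨x, y, _ | _⟩ <;> simp [stripStep, neighbor] <;> omega
  have h6 : #(P.image Face.row) ≤ #(exits (stripStep 0 1) P) := by
    refine card_image_le_card_exits (pos := fun f => f.y - f.x) ?_ ?_ <;>
      rintro ⟨x, y, _ | _⟩ <;> simp [stripStep, neighbor] <;> omega
  have := two_mul_edgePerimeter P
  omega

/-! ### Connectedness -/

/-- A coordinate that changes by at most one across an edge takes on a polyiamond all values
between any two of its values. -/
theorem IsPolyiamond.exists_eq {P : Finset Face} (hP : IsPolyiamond P) {c : Face → ℤ}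
    (hc : ∀ d f, c (neighbor d f) ≤ c f + 1) {f g : Face} (hf : f ∈ P) (hg : g ∈ P) {k : ℤ}
    (hfk : c f ≤ k) (hkg : k ≤ c g) : ∃ h ∈ P, c h = k := by
  by_contra! hne
  have hreach : Relation.ReflTransGen (faceGraph.induce (P : Set Face)).Adj ⟨f, hf⟩ ⟨g, hg⟩ :=
    (SimpleGraph.reachable_iff_reflTransGen _ _).1 (hP.preconnected _ _)
  -- Along a path from `f` the coordinate starts below `k`, rises by at most one per step and never
  -- equals `k`, so it stays below `k`.
  have key : ∀ a : (P : Set Face),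
      Relation.ReflTransGen (faceGraph.induce (P : Set Face)).Adj ⟨f, hf⟩ a → c a < k := by
    intro a ha
    induction ha with
    | refl => exact lt_of_le_of_ne hfk (hne f hf)
    | @tail a b _ hab ih =>
      obtain ⟨d, hd⟩ := exists_neighbor_of_adj (f := a) (g := b) hab
      have h1 := hc d a
      have h2 := hne b b.2
      rw [← hd] at h1
      omega
  exact absurd (key _ hreach) (not_lt.2 hkg)

/-- The values of a coordinate on a polyiamond form an interval. -/
theorem IsPolyiamond.exists_image_eq_Ico {P : Finset Face} (hP : IsPolyiamond P) {c : Face → ℤ}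
    (hc : ∀ d f, c (neighbor d f) ≤ c f + 1) :
    ∃ a b : ℤ, a < b ∧ P.image c = Ico a b := by
  obtain ⟨⟨f₀, hf₀⟩⟩ := hP.nonempty
  obtain ⟨f, hf, hmin⟩ := exists_min_image P c ⟨f₀, hf₀⟩
  obtain ⟨g, hg, hmax⟩ := exists_max_image P c ⟨f₀, hf₀⟩
  refine ⟨c f, c g + 1, by have := hmin g hg; omega, ?_⟩
  ext k
  rw [mem_image, mem_Ico]
  constructor
  · rintro ⟨h, hh, rfl⟩
    have h1 := hmin h hh
    have h2 := hmax h hh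
    omega
  · rintro ⟨h1, h2⟩
    exact hP.exists_eq hc hf hg h1 (by omega)

/-! ### Lattice hexagons -/

/-- The bounds of a (possibly degenerate) lattice hexagon in the three strip coordinates. -/
@[ext] structure HexBounds where
  x₀ : ℤ
  x₁ : ℤ
  y₀ : ℤ
  y₁ : ℤ
  z₀ : ℤ
  z₁ : ℤ

namespace HexBounds

/-- The faces within the bounds. -/
noncomputable def faces (h : HexBounds) : Finset Face :=
  {f ∈ (Ico h.x₀ h.x₁ ×ˢ Ico h.y₀ h.y₁ ×ˢ (univ : Finset Bool)).image
    fun a => (⟨a.1, a.2.1, a.2.2⟩ : Face) | h.z₀ ≤ f.row ∧ f.row < h.z₁}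

theorem mem_faces {h : HexBounds} {f : Face} :
    f ∈ h.faces ↔ (h.x₀ ≤ f.x ∧ f.x < h.x₁) ∧ (h.y₀ ≤ f.y ∧ f.y < h.y₁) ∧
      (h.z₀ ≤ f.row ∧ f.row < h.z₁) := by
  rw [faces, mem_filter, mem_image, ← and_assoc (c := h.z₀ ≤ f.row ∧ f.row < h.z₁)]
  refine and_congr_left fun _ => ⟨?_, fun hf => ?_⟩
  · rintro ⟨⟨x, y, b⟩, ha, rfl⟩
    simpa using ha
  · exact ⟨(f.x, f.y, f.down), by simpa using hf, rfl⟩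

/-! ### Area of lattice hexagons -/

/-- The up-pointing triangle of side `l` with corner `(p, q)`. -/
def triangle (p q l : ℤ) : HexBounds := ⟨p, p + l, q, q + l, p + q, p + q + l⟩

theorem card_triangle (l : ℕ) (p q : ℤ) : #(triangle p q l).faces = l ^ 2 := by
  induction l generalizing p with
  | zero =>
    rw [card_eq_zero.2, zero_pow two_ne_zero]
    ext f
    simp [mem_faces, triangle]
  | succ l ih =>
    -- The strip `x = p` of the larger triangle is a bar of `2 * l + 1` faces, alternately up and
    -- down: position `t` is a down face exactly when `t` is odd.
    have hinj : Function.Injective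
        fun t : ℕ => (⟨p, q + (t / 2 : ℕ), t % 2 = 1⟩ : Face) := by
      intro s t hst
      simp only [Face.mk.injEq, decide_eq_decide, true_and] at hst
      omega
    have hdis : Disjoint (triangle (p + 1) q l).faces ((range (2 * l + 1)).image
        fun t : ℕ => (⟨p, q + (t / 2 : ℕ), t % 2 = 1⟩ : Face)) := by
      rw [disjoint_left]
      intro f hf hf'
      obtain ⟨t, -, rfl⟩ := mem_image.1 hf'
      simp [mem_faces, triangle] at hf
    have hunion : (triangle p q (l + 1 : ℕ)).faces = (triangle (p + 1) q l).faces ∪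
        (range (2 * l + 1)).image
          fun t : ℕ => (⟨p, q + (t / 2 : ℕ), t % 2 = 1⟩ : Face) := by
      ext f
      rw [mem_union, mem_image, mem_faces, mem_faces]
      constructor
      · intro hf
        by_cases hp : f.x = p
        · right
          rcases f with ⟨x, y, _ | _⟩
          · refine ⟨2 * (y - q).toNat, ?_, ?_⟩ <;> simp [triangle] at hf hp ⊢ <;> omega
          · refine ⟨2 * (y - q).toNat + 1, ?_, ?_⟩ <;> simp [triangle] at hf hp ⊢ <;> omega
        · left
          rcases f with ⟨x, y, _ | _⟩ <;> simp [triangle] at hf hp ⊢ <;> omega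
      · rintro (hf | ⟨t, ht, rfl⟩)
        · rcases f with ⟨x, y, _ | _⟩ <;> simp [triangle] at hf ⊢ <;> omega
        · rw [mem_range] at ht
          rcases Nat.mod_two_eq_zero_or_one t with h | h <;> simp [triangle, h] <;> omega
    rw [hunion, card_union_of_disjoint hdis, ih, card_image_of_injective _ hinj, card_range]
    ring

theorem card_triangle_int {l : ℤ} (hl : 0 ≤ l) (p q : ℤ) :
    (#(triangle p q l).faces : ℤ) = l ^ 2 := by
  lift l to ℕ using hl
  rw [card_triangle]
  push_cast
  rfl

/-- All six sides of the hexagon have nonnegative length. -/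
structure Valid (h : HexBounds) : Prop where
  side_x₁ : h.x₁ + h.y₀ ≤ h.z₁
  side_y₁ : h.x₀ + h.y₁ ≤ h.z₁
  side_z₀ : h.x₀ + h.y₀ ≤ h.z₀
  side_z₁ : h.z₁ ≤ h.x₁ + h.y₁
  side_x₀ : h.z₀ ≤ h.x₀ + h.y₁
  side_y₀ : h.z₀ ≤ h.x₁ + h.y₀

/-- The perimeter of the hexagon, for valid bounds. -/
def perim (h : HexBounds) : ℤ := (h.x₁ - h.x₀) + (h.y₁ - h.y₀) + (h.z₁ - h.z₀)

/-- The side of the up-pointing triangle cut out by three sides of the hexagon. -/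
def size (h : HexBounds) : ℤ := h.z₁ - h.x₀ - h.y₀

/-- The isoperimetric deficit `perim ^ 2 - 6 * area`. -/
def deficit (h : HexBounds) : ℤ :=
  3 * (h.perim - 2 * h.size) ^ 2 +
    2 * (((h.x₁ - h.x₀) - (h.y₁ - h.y₀)) ^ 2 + ((h.y₁ - h.y₀) - (h.z₁ - h.z₀)) ^ 2 +
      ((h.z₁ - h.z₀) - (h.x₁ - h.x₀)) ^ 2)

/-- A valid hexagon is an up-pointing triangle without three up-pointing corners. -/
theorem Valid.card_faces {h : HexBounds} (hv : h.Valid) :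
    (#h.faces : ℤ) = h.size ^ 2 - (h.z₁ - h.x₁ - h.y₀) ^ 2 - (h.z₁ - h.x₀ - h.y₁) ^ 2 -
      (h.z₀ - h.x₀ - h.y₀) ^ 2 := by
  obtain ⟨h1, h2, h3, h4, h5, h6⟩ := hv
  have hT := card_triangle_int (l := h.size) (by unfold size; omega) h.x₀ h.y₀
  have hA := card_triangle_int (l := h.z₁ - h.x₁ - h.y₀) (by omega) h.x₁ h.y₀
  have hB := card_triangle_int (l := h.z₁ - h.x₀ - h.y₁) (by omega) h.x₀ h.y₁
  have hC := card_triangle_int (l := h.z₀ - h.x₀ - h.y₀) (by omega) h.x₀ h.y₀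
  set A := (triangle h.x₁ h.y₀ (h.z₁ - h.x₁ - h.y₀)).faces with hAdef
  set B := (triangle h.x₀ h.y₁ (h.z₁ - h.x₀ - h.y₁)).faces with hBdef
  set C := (triangle h.x₀ h.y₀ (h.z₀ - h.x₀ - h.y₀)).faces with hCdef
  have d1 : Disjoint h.faces A := by
    rw [disjoint_left]
    intro f
    simp only [hAdef, mem_faces, triangle]
    omega
  have d2 : Disjoint (h.faces ∪ A) B := by
    rw [disjoint_left]
    rintro ⟨x, y, _ | _⟩ <;> simp only [hAdef, hBdef, mem_union, mem_faces, triangle, row_false,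
      row_true] <;> omega
  have d3 : Disjoint (h.faces ∪ A ∪ B) C := by
    rw [disjoint_left]
    rintro ⟨x, y, _ | _⟩ <;> simp only [hAdef, hBdef, hCdef, mem_union, mem_faces, triangle,
      row_false, row_true] <;> omega
  have hunion : (triangle h.x₀ h.y₀ h.size).faces = h.faces ∪ A ∪ B ∪ C := by
    ext ⟨x, y, _ | _⟩ <;> simp only [hAdef, hBdef, hCdef, mem_union, mem_faces, triangle,
      row_false, row_true, size] <;> omega
  rw [hunion, card_union_of_disjoint d3, card_union_of_disjoint d2,
    card_union_of_disjoint d1] at hT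
  push_cast at hT
  linarith

/-- Together with `deficit_nonneg` this is the isoperimetric inequality for hexagons. -/
theorem Valid.six_mul_card_faces {h : HexBounds} (hv : h.Valid) :
    6 * (#h.faces : ℤ) = h.perim ^ 2 - h.deficit := by
  rw [hv.card_faces]
  simp only [deficit, perim, size]
  ring

theorem Valid.card_faces_mod_two {h : HexBounds} (hv : h.Valid) :
    (#h.faces : ℤ) % 2 = h.perim % 2 := by
  have key : ∀ a : ℤ, ∃ k, a ^ 2 = a + 2 * k := fun a => by
    -- `a ^ 2` and `a` have the same parity, so the area formula becomes linear modulo `2`.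
    obtain ⟨k, hk⟩ := Int.even_mul_pred_self a
    exact ⟨k, by linear_combination hk⟩
  obtain ⟨k₁, hk₁⟩ := key h.size
  obtain ⟨k₂, hk₂⟩ := key (h.z₁ - h.x₁ - h.y₀)
  obtain ⟨k₃, hk₃⟩ := key (h.z₁ - h.x₀ - h.y₁)
  obtain ⟨k₄, hk₄⟩ := key (h.z₀ - h.x₀ - h.y₀)
  rw [hv.card_faces, hk₁, hk₂, hk₃, hk₄]
  simp only [size, perim]
  omega

theorem deficit_nonneg (h : HexBounds) : 0 ≤ h.deficit := by
  unfold deficit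
  positivity

/-! ### Perimeter of lattice hexagons -/

theorem card_exits_le {h : HexBounds} {s c : Face → _} {a b : ℤ} (hab : a ≤ b)
    (hc : ∀ f ∈ h.faces, a ≤ c f ∧ c f < b)
    (hinj : Set.InjOn c (exits s h.faces : Finset Face)) :
    (#(exits s h.faces) : ℤ) ≤ b - a := by
  have := card_le_card_of_injOn (t := Ico a b) c
    (fun f hf => mem_coe.2 (mem_Ico.2 (hc f (mem_exits.1 hf).1))) hinj
  rw [Int.card_Ico] at this
  omega

/-- A hexagon meets each strip in a contiguous run of faces, so an oriented strip has at most one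
exit and the strip coordinate is injective on exits. -/
theorem edgePerimeter_faces_le {h : HexBounds} (hx : h.x₀ ≤ h.x₁) (hy : h.y₀ ≤ h.y₁)
    (hz : h.z₀ ≤ h.z₁) : (edgePerimeter h.faces : ℤ) ≤ h.perim := by
  have h1 : (#(exits (stripStep 2 1) h.faces) : ℤ) ≤ h.x₁ - h.x₀ := by
    refine card_exits_le (c := Face.x) hx (fun f hf => (mem_faces.1 hf).1) ?_
    rintro ⟨x, y, _ | _⟩ hf ⟨x', y', _ | _⟩ hg hc <;>
      simp [mem_exits, mem_faces, stripStep, neighbor] at hf hg hc ⊢ <;> omega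
  have h2 : (#(exits (stripStep 1 2) h.faces) : ℤ) ≤ h.x₁ - h.x₀ := by
    refine card_exits_le (c := Face.x) hx (fun f hf => (mem_faces.1 hf).1) ?_
    rintro ⟨x, y, _ | _⟩ hf ⟨x', y', _ | _⟩ hg hc <;>
      simp [mem_exits, mem_faces, stripStep, neighbor] at hf hg hc ⊢ <;> omega
  have h3 : (#(exits (stripStep 2 0) h.faces) : ℤ) ≤ h.y₁ - h.y₀ := by
    refine card_exits_le (c := Face.y) hy (fun f hf => (mem_faces.1 hf).2.1) ?_
    rintro ⟨x, y, _ | _⟩ hf ⟨x', y', _ | _⟩ hg hc <;>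
      simp [mem_exits, mem_faces, stripStep, neighbor] at hf hg hc ⊢ <;> omega
  have h4 : (#(exits (stripStep 0 2) h.faces) : ℤ) ≤ h.y₁ - h.y₀ := by
    refine card_exits_le (c := Face.y) hy (fun f hf => (mem_faces.1 hf).2.1) ?_
    rintro ⟨x, y, _ | _⟩ hf ⟨x', y', _ | _⟩ hg hc <;>
      simp [mem_exits, mem_faces, stripStep, neighbor] at hf hg hc ⊢ <;> omega
  have h5 : (#(exits (stripStep 1 0) h.faces) : ℤ) ≤ h.z₁ - h.z₀ := by
    refine card_exits_le (c := Face.row) hz (fun f hf => (mem_faces.1 hf).2.2) ?_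
    rintro ⟨x, y, _ | _⟩ hf ⟨x', y', _ | _⟩ hg hc <;>
      simp [mem_exits, mem_faces, stripStep, neighbor] at hf hg hc ⊢ <;> omega
  have h6 : (#(exits (stripStep 0 1) h.faces) : ℤ) ≤ h.z₁ - h.z₀ := by
    refine card_exits_le (c := Face.row) hz (fun f hf => (mem_faces.1 hf).2.2) ?_
    rintro ⟨x, y, _ | _⟩ hf ⟨x', y', _ | _⟩ hg hc <;>
      simp [mem_exits, mem_faces, stripStep, neighbor] at hf hg hc ⊢ <;> omega
  have := two_mul_edgePerimeter h.faces
  unfold perim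
  omega

/-! ### Rotations, translations and the bounds of quasi-regular hexagons -/

/-- The bounds of the image under `rotateFace`. -/
def rotate (h : HexBounds) : HexBounds := ⟨-h.y₁, -h.y₀, h.z₀, h.z₁, h.x₀, h.x₁⟩

/-- The bounds of the image under `translateFace v`. -/
def translate (v : Vertex) (h : HexBounds) : HexBounds :=
  ⟨h.x₀ + v.1, h.x₁ + v.1, h.y₀ + v.2, h.y₁ + v.2, h.z₀ + (v.1 + v.2), h.z₁ + (v.1 + v.2)⟩

theorem image_rotateFace (h : HexBounds) :
    rotateFace '' (h.faces : Set Face) = h.rotate.faces := by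
  ext g
  rw [Set.mem_image, mem_coe]
  constructor
  · rintro ⟨⟨x, y, _ | _⟩, hf, rfl⟩ <;>
      simp [mem_faces, rotate, rotateFace] at hf ⊢ <;> omega
  · intro hg
    rcases g with ⟨x, y, _ | _⟩
    · refine ⟨⟨x + y, -x - 1, true⟩, ?_, ?_⟩ <;>
        simp [mem_faces, rotate, rotateFace] at hg ⊢ <;> omega
    · refine ⟨⟨x + y + 1, -x - 1, false⟩, ?_, ?_⟩ <;>
        simp [mem_faces, rotate, rotateFace] at hg ⊢ <;> omega

theorem image_translateFace (v : Vertex) (h : HexBounds) :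
    translateFace v '' (h.faces : Set Face) = (h.translate v).faces := by
  ext g
  rw [Set.mem_image, mem_coe]
  constructor
  · rintro ⟨⟨x, y, _ | _⟩, hf, rfl⟩ <;>
      simp [mem_faces, translate, translateFace] at hf ⊢ <;> omega
  · intro hg
    rcases g with ⟨x, y, b⟩
    refine ⟨⟨x - v.1, y - v.2, b⟩, ?_, ?_⟩ <;> rcases b with _ | _ <;>
      simp [mem_faces, translate, translateFace] at hg ⊢ <;> omega

theorem rotate_iterate_six (h : HexBounds) : rotate^[6] h = h := by
  simp [rotate]

theorem image_rotateFace_iterate (z : ℕ) (h : HexBounds) :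
    rotateFace^[z] '' (h.faces : Set Face) = (rotate^[z] h).faces := by
  induction z with
  | zero => simp
  | succ z ih =>
    rw [Function.iterate_succ', Set.image_comp, ih, image_rotateFace,
      Function.iterate_succ_apply']

/-- The bounds of `hexagonWithBars r i`. -/
def quasiRegular (r i : ℕ) : HexBounds where
  x₀ := -r - if 3 ≤ i then 1 else 0
  x₁ := r + if 6 ≤ i then 1 else 0
  y₀ := -r - if 5 ≤ i then 1 else 0
  y₁ := r + if 2 ≤ i then 1 else 0
  z₀ := -r - if 4 ≤ i then 1 else 0
  z₁ := r + if 1 ≤ i then 1 else 0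

theorem hexagonWithBars_eq {r i : ℕ} (hr : 1 ≤ r) (hi : i ≤ 6) :
    hexagonWithBars r i = (quasiRegular r i).faces := by
  induction i with
  | zero =>
    ext f
    simp [hexagonWithBars, regularHexagon, mem_faces, quasiRegular]
    tauto
  | succ i ih =>
    rw [hexagonWithBars, ih (by omega)]
    have hi' : i < 6 := by omega
    clear ih hi
    ext ⟨x, y, _ | _⟩ <;> interval_cases i <;>
      simp [bar, mem_faces, quasiRegular, upTriangle, downTriangle] <;> omega

/-- Valid bounds stay valid under rotations and translations, which also preserve the perimeter
and the deficit. -/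
theorem Valid.rotate {h : HexBounds} (hv : h.Valid) : h.rotate.Valid := by
  obtain ⟨h1, h2, h3, h4, h5, h6⟩ := hv
  constructor <;> simp only [HexBounds.rotate] <;> omega

theorem Valid.translate {h : HexBounds} (hv : h.Valid) (v : Vertex) : (h.translate v).Valid := by
  obtain ⟨h1, h2, h3, h4, h5, h6⟩ := hv
  constructor <;> simp only [HexBounds.translate] <;> omega

@[simp] theorem perim_rotate (h : HexBounds) : h.rotate.perim = h.perim := by
  simp only [perim, rotate]; ring

@[simp] theorem deficit_rotate (h : HexBounds) : h.rotate.deficit = h.deficit := by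
  simp only [deficit, perim, size, rotate]; ring

@[simp] theorem perim_translate (v : Vertex) (h : HexBounds) :
    (h.translate v).perim = h.perim := by
  simp only [perim, translate]; ring

@[simp] theorem deficit_translate (v : Vertex) (h : HexBounds) :
    (h.translate v).deficit = h.deficit := by
  simp only [deficit, perim, size, translate]; ring

theorem rotate_iterate_invariants (z : ℕ) {h : HexBounds} (hv : h.Valid) :
    (HexBounds.rotate^[z] h).Valid ∧ (HexBounds.rotate^[z] h).perim = h.perim ∧
      (HexBounds.rotate^[z] h).deficit = h.deficit := by
  induction z with
  | zero => exact ⟨hv, rfl, rfl⟩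
  | succ z ih =>
    rw [Function.iterate_succ_apply', perim_rotate, deficit_rotate]
    exact ⟨ih.1.rotate, ih.2⟩

theorem valid_quasiRegular {r i : ℕ} (hr : 1 ≤ r) : (quasiRegular r i).Valid := by
  constructor <;> simp only [quasiRegular] <;> split_ifs <;> omega

theorem perim_quasiRegular {r i : ℕ} (hi : i ≤ 6) :
    (quasiRegular r i).perim = 6 * r + i := by
  interval_cases i <;> simp [perim, quasiRegular] <;> ring

/-- The values for `i = 0, …, 6` are `0, 7, 4, 3, 4, 7, 0`, independently of `r`. -/
theorem deficit_quasiRegular_le {r i : ℕ} (hi : i ≤ 6) : (quasiRegular r i).deficit ≤ 7 := by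
  have h1 := perim_quasiRegular (r := r) hi
  rw [deficit, h1]
  interval_cases i <;> simp [size, quasiRegular] <;> ring_nf <;> norm_num

end HexBounds

/-! ### Quasi-regular hexagons -/

open HexBounds

theorem isQuasiRegularHexagon_iff {P : Finset Face} : IsQuasiRegularHexagon P ↔
    ∃ r i z : ℕ, ∃ v : Vertex, 1 ≤ r ∧ i ≤ 6 ∧
      P = ((HexBounds.rotate^[z] (quasiRegular r i)).translate v).faces := by
  refine exists₄_congr fun r i z v => and_congr_right fun hr => and_congr_right fun hi => ?_
  rw [hexagonWithBars_eq hr hi, ← Function.comp_def, Set.image_comp, image_rotateFace_iterate,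
    image_translateFace, coe_inj]

/-- These bounds are all that the isoperimetric argument uses about the given quasi-regular hexagon.
-/
theorem IsQuasiRegularHexagon.exists_bounds {P : Finset Face} (hP : IsQuasiRegularHexagon P) :
    ∃ h : HexBounds, P = h.faces ∧ h.Valid ∧ 6 ≤ h.perim ∧ h.deficit ≤ 7 := by
  obtain ⟨r, i, z, v, hr, hi, rfl⟩ := isQuasiRegularHexagon_iff.1 hP
  obtain ⟨h1, h2, h3⟩ := rotate_iterate_invariants z (valid_quasiRegular (i := i) hr)
  refine ⟨_, rfl, h1.translate v, ?_, ?_⟩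
  · rw [perim_translate, h2, perim_quasiRegular hi]
    omega
  · rw [deficit_translate, h3]
    exact deficit_quasiRegular_le hi

theorem IsQuasiRegularHexagon.rotate {h : HexBounds} (hh : IsQuasiRegularHexagon h.faces) :
    IsQuasiRegularHexagon h.rotate.faces := by
  rw [isQuasiRegularHexagon_iff] at hh ⊢
  obtain ⟨r, i, z, v, hr, hi, heq⟩ := hh
  -- Rotating after translating by `v` is translating by the rotated vector after rotating.
  refine ⟨r, i, z + 1, (-v.2, v.1 + v.2), hr, hi, ?_⟩
  rw [← coe_inj, ← image_rotateFace, heq, image_rotateFace, Function.iterate_succ_apply']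
  congr 2
  ext <;> simp only [HexBounds.rotate, HexBounds.translate] <;> ring

theorem IsQuasiRegularHexagon.of_rotate {h : HexBounds}
    (hh : IsQuasiRegularHexagon h.rotate.faces) : IsQuasiRegularHexagon h.faces := by
  have := hh.rotate.rotate.rotate.rotate.rotate
  rwa [show h.rotate.rotate.rotate.rotate.rotate.rotate = h from rotate_iterate_six h] at this

/-- The widths and the size determine a hexagon up to translations. -/
theorem isQuasiRegularHexagon_of_widths {h : HexBounds} {r i : ℕ} (hr : 1 ≤ r) (hi : i ≤ 6)
    (hx : h.x₁ - h.x₀ = (quasiRegular r i).x₁ - (quasiRegular r i).x₀)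
    (hy : h.y₁ - h.y₀ = (quasiRegular r i).y₁ - (quasiRegular r i).y₀)
    (hz : h.z₁ - h.z₀ = (quasiRegular r i).z₁ - (quasiRegular r i).z₀)
    (hn : h.size = (quasiRegular r i).size) : IsQuasiRegularHexagon h.faces := by
  refine isQuasiRegularHexagon_iff.2 ⟨r, i, 0,
    (h.x₀ - (quasiRegular r i).x₀, h.y₀ - (quasiRegular r i).y₀), hr, hi, ?_⟩
  unfold size at hn
  congr 1
  ext <;> simp only [HexBounds.translate, Function.iterate_zero, id] <;> omega

theorem abs_le_one_of_sq_lt {a : ℤ} (ha : a ^ 2 < 4) : -1 ≤ a ∧ a ≤ 1 := by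
  constructor <;> nlinarith

/-- The widths and the size of `quasiRegular r i`, relative to `2 * r` and `3 * r`. -/
def IsQuasiRegularExcess (i : ℕ) (u v w t : ℤ) : Prop :=
  u = (if 3 ≤ i then 1 else 0) + (if 6 ≤ i then 1 else 0) ∧
    v = (if 2 ≤ i then 1 else 0) + (if 5 ≤ i then 1 else 0) ∧
    w = (if 1 ≤ i then 1 else 0) + (if 4 ≤ i then 1 else 0) ∧
    t = (if 1 ≤ i then 1 else 0) + (if 3 ≤ i then 1 else 0) + (if 5 ≤ i then 1 else 0)

/-- A rotation by `π / 3` permutes the widths cyclically and replaces `size` by `perim - size`, that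
is, `t` by `i - t`; the six alternatives are the six rotations. Widths with sum `i` and differences
at most one are unique up to a cyclic shift, and `t` is unique up to `t ↦ i - t`. -/
theorem exists_isQuasiRegularExcess {i : ℕ} (hi : i < 6) {u v w t : ℤ} (hs : u + v + w = i)
    (huv : -1 ≤ u - v ∧ u - v ≤ 1) (hvw : -1 ≤ v - w ∧ v - w ≤ 1)
    (hwu : -1 ≤ w - u ∧ w - u ≤ 1) (ht : -1 ≤ i - 2 * t ∧ i - 2 * t ≤ 1) :
    IsQuasiRegularExcess i u v w t ∨ IsQuasiRegularExcess i v w u (i - t) ∨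
    IsQuasiRegularExcess i w u v t ∨ IsQuasiRegularExcess i u v w (i - t) ∨
    IsQuasiRegularExcess i v w u t ∨ IsQuasiRegularExcess i w u v (i - t) := by
  obtain rfl : w = i - u - v := by omega
  unfold IsQuasiRegularExcess
  have ht1 : 0 ≤ t := by omega
  have ht2 : t ≤ 3 := by omega
  interval_cases i <;> interval_cases t <;> omega

theorem isQuasiRegularHexagon_of_excess {h : HexBounds} {r i : ℕ} (hr : 1 ≤ r) (hi : i ≤ 6)
    (hh : IsQuasiRegularExcess i (h.x₁ - h.x₀ - 2 * r) (h.y₁ - h.y₀ - 2 * r)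
      (h.z₁ - h.z₀ - 2 * r) (h.size - 3 * r)) : IsQuasiRegularHexagon h.faces := by
  obtain ⟨h1, h2, h3, h4⟩ := hh
  refine isQuasiRegularHexagon_of_widths hr hi ?_ ?_ ?_ ?_ <;>
    simp only [quasiRegular, size] at * <;> linarith

/-- Hexagons with small isoperimetric deficit are quasi-regular. -/
theorem isQuasiRegularHexagon_of_deficit_le {h : HexBounds} (hp : 6 ≤ h.perim)
    (hd : h.deficit ≤ 7) : IsQuasiRegularHexagon h.faces := by
  have h0 : -1 ≤ h.perim - 2 * h.size ∧ h.perim - 2 * h.size ≤ 1 := by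
    apply abs_le_one_of_sq_lt
    unfold deficit at hd
    nlinarith [sq_nonneg ((h.x₁ - h.x₀) - (h.y₁ - h.y₀)),
      sq_nonneg ((h.y₁ - h.y₀) - (h.z₁ - h.z₀)), sq_nonneg ((h.z₁ - h.z₀) - (h.x₁ - h.x₀))]
  have h1 : -1 ≤ (h.x₁ - h.x₀) - (h.y₁ - h.y₀) ∧ (h.x₁ - h.x₀) - (h.y₁ - h.y₀) ≤ 1 := by
    apply abs_le_one_of_sq_lt
    unfold deficit at hd
    nlinarith [sq_nonneg (h.perim - 2 * h.size),
      sq_nonneg ((h.y₁ - h.y₀) - (h.z₁ - h.z₀)), sq_nonneg ((h.z₁ - h.z₀) - (h.x₁ - h.x₀))]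
  have h2 : -1 ≤ (h.y₁ - h.y₀) - (h.z₁ - h.z₀) ∧ (h.y₁ - h.y₀) - (h.z₁ - h.z₀) ≤ 1 := by
    apply abs_le_one_of_sq_lt
    unfold deficit at hd
    nlinarith [sq_nonneg (h.perim - 2 * h.size),
      sq_nonneg ((h.x₁ - h.x₀) - (h.y₁ - h.y₀)), sq_nonneg ((h.z₁ - h.z₀) - (h.x₁ - h.x₀))]
  have h3 : -1 ≤ (h.z₁ - h.z₀) - (h.x₁ - h.x₀) ∧ (h.z₁ - h.z₀) - (h.x₁ - h.x₀) ≤ 1 := by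
    apply abs_le_one_of_sq_lt
    unfold deficit at hd
    nlinarith [sq_nonneg (h.perim - 2 * h.size),
      sq_nonneg ((h.x₁ - h.x₀) - (h.y₁ - h.y₀)), sq_nonneg ((h.y₁ - h.y₀) - (h.z₁ - h.z₀))]
  clear hd
  -- Division of the perimeter by `6`; `6 ≤ h.perim` ensures `1 ≤ r`.
  obtain ⟨r, i, hr, hi, hpi⟩ : ∃ r i : ℕ, 1 ≤ r ∧ i < 6 ∧ h.perim = 6 * r + i :=
    ⟨h.perim.toNat / 6, h.perim.toNat % 6, by omega, by omega, by omega⟩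
  have hi6 : i ≤ 6 := hi.le
  have key : ∀ g : HexBounds, IsQuasiRegularHexagon g.rotate.faces →
      IsQuasiRegularHexagon g.faces := fun g => .of_rotate
  have hsum := hpi
  unfold perim at hsum
  rcases exists_isQuasiRegularExcess hi (u := h.x₁ - h.x₀ - 2 * r) (v := h.y₁ - h.y₀ - 2 * r)
    (w := h.z₁ - h.z₀ - 2 * r) (t := h.size - 3 * r) (by omega) (by omega) (by omega) (by omega)
    (by omega) with e | e | e | e | e | e
  · exact isQuasiRegularHexagon_of_excess hr hi6 e
  · refine key _ (isQuasiRegularHexagon_of_excess hr hi6 ?_)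
    convert e using 1 <;> simp only [HexBounds.rotate, size] at * <;> omega
  · refine key _ (key _ (isQuasiRegularHexagon_of_excess hr hi6 ?_))
    convert e using 1 <;> simp only [HexBounds.rotate, size] at * <;> omega
  · refine key _ (key _ (key _ (isQuasiRegularHexagon_of_excess hr hi6 ?_)))
    convert e using 1 <;> simp only [HexBounds.rotate, size] at * <;> omega
  · refine key _ (key _ (key _ (key _ (isQuasiRegularHexagon_of_excess hr hi6 ?_))))
    convert e using 1 <;> simp only [HexBounds.rotate, size] at * <;> omega
  · refine key _ (key _ (key _ (key _ (key _ (isQuasiRegularHexagon_of_excess hr hi6 ?_)))))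
    convert e using 1 <;> simp only [HexBounds.rotate, size] at * <;> omega

/-! ### The isoperimetric inequality -/

/-- A polyiamond lies in a valid hexagon whose perimeter is at most that of the polyiamond. -/
theorem IsPolyiamond.exists_bounds {P : Finset Face} (hP : IsPolyiamond P) :
    ∃ h : HexBounds, P ⊆ h.faces ∧ h.Valid ∧ 0 ≤ h.perim ∧ h.perim ≤ edgePerimeter P := by
  obtain ⟨x₀, x₁, hx, hX⟩ := hP.exists_image_eq_Ico (c := Face.x) (by
    rintro d ⟨x, y, _ | _⟩ <;> fin_cases d <;> simp [neighbor] <;> omega)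
  obtain ⟨y₀, y₁, hy, hY⟩ := hP.exists_image_eq_Ico (c := Face.y) (by
    rintro d ⟨x, y, _ | _⟩ <;> fin_cases d <;> simp [neighbor] <;> omega)
  obtain ⟨z₀, z₁, hz, hZ⟩ := hP.exists_image_eq_Ico (c := Face.row) (by
    rintro d ⟨x, y, _ | _⟩ <;> fin_cases d <;> simp [neighbor] <;> omega)
  have mX : ∀ f ∈ P, x₀ ≤ f.x ∧ f.x < x₁ := fun f hf =>
    mem_Ico.1 (hX ▸ mem_image_of_mem Face.x hf)
  have mY : ∀ f ∈ P, y₀ ≤ f.y ∧ f.y < y₁ := fun f hf =>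
    mem_Ico.1 (hY ▸ mem_image_of_mem Face.y hf)
  have mZ : ∀ f ∈ P, z₀ ≤ f.row ∧ f.row < z₁ := fun f hf =>
    mem_Ico.1 (hZ ▸ mem_image_of_mem Face.row hf)
  have eX : ∀ k, x₀ ≤ k ∧ k < x₁ → ∃ f ∈ P, f.x = k := fun k hk =>
    mem_image.1 (hX ▸ mem_Ico.2 hk)
  have eY : ∀ k, y₀ ≤ k ∧ k < y₁ → ∃ f ∈ P, f.y = k := fun k hk =>
    mem_image.1 (hY ▸ mem_Ico.2 hk)
  have eZ : ∀ k, z₀ ≤ k ∧ k < z₁ → ∃ f ∈ P, f.row = k := fun k hk =>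
    mem_image.1 (hZ ▸ mem_Ico.2 hk)
  have row_bounds : ∀ f : Face, f.x + f.y ≤ f.row ∧ f.row ≤ f.x + f.y + 1 := by
    rintro ⟨x, y, _ | _⟩ <;> simp
  have sides : ∀ f ∈ P, x₀ ≤ f.x ∧ f.x < x₁ ∧ y₀ ≤ f.y ∧ f.y < y₁ ∧ z₀ ≤ f.row ∧ f.row < z₁ ∧
      f.x + f.y ≤ f.row ∧ f.row ≤ f.x + f.y + 1 := fun f hf =>
    ⟨(mX f hf).1, (mX f hf).2, (mY f hf).1, (mY f hf).2, (mZ f hf).1, (mZ f hf).2,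
      row_bounds f⟩
  have hle := card_images_le_edgePerimeter P
  rw [hX, hY, hZ, Int.card_Ico, Int.card_Ico, Int.card_Ico] at hle
  refine ⟨⟨x₀, x₁, y₀, y₁, z₀, z₁⟩, fun f hf => mem_faces.2 ⟨mX f hf, mY f hf, mZ f hf⟩,
    ⟨?_, ?_, ?_, ?_, ?_, ?_⟩, ?_, ?_⟩
  -- Each side has nonnegative length because the extreme strip along it contains a face of `P`,
  -- which respects the other two bounds.
  · obtain ⟨f, hf, h⟩ := eX (x₁ - 1) (by omega)
    have := sides f hf
    dsimp only; omega
  · obtain ⟨f, hf, h⟩ := eY (y₁ - 1) (by omega)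
    have := sides f hf
    dsimp only; omega
  · obtain ⟨f, hf, h⟩ := eZ z₀ (by omega)
    have := sides f hf
    dsimp only; omega
  · obtain ⟨f, hf, h⟩ := eZ (z₁ - 1) (by omega)
    have := sides f hf
    dsimp only; omega
  · obtain ⟨f, hf, h⟩ := eX x₀ (by omega)
    have := sides f hf
    dsimp only; omega
  · obtain ⟨f, hf, h⟩ := eY y₀ (by omega)
    have := sides f hf
    dsimp only; omega
  · simp only [perim]; omega
  · simp only [perim]; omega

/-- A polyiamond with the area of a valid hexagon of deficit at most `7` has a perimeter that
exceeds that of the hexagon by at least two, unless it is quasi-regular. -/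
theorem IsPolyiamond.perim_add_two_le {P : Finset Face} (hP : IsPolyiamond P) {e : HexBounds}
    (he : e.Valid) (hp : 6 ≤ e.perim) (hd : e.deficit ≤ 7) (hA : #P = #e.faces)
    (hne : ¬ IsQuasiRegularHexagon P) : e.perim + 2 ≤ edgePerimeter P := by
  by_contra! hlt
  obtain ⟨h, hPh, hv, h0, hle⟩ := hP.exists_bounds
  have hmod := edgePerimeter_mod_two P
  rw [area, hA] at hmod
  have hmod_e := he.card_faces_mod_two
  have hmod_h := hv.card_faces_mod_two
  have harea_e := he.six_mul_card_faces
  have harea_h := hv.six_mul_card_faces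
  have hcard := card_le_card hPh
  have hdef := h.deficit_nonneg
  -- Parity first improves `hlt` to `edgePerimeter P ≤ e.perim`. A strictly smaller `h.perim` would
  -- give `6 * #P ≤ (e.perim - 1) ^ 2 < e.perim ^ 2 - 7`, the last step by `6 ≤ e.perim`.
  have hperim : h.perim = e.perim := by
    have : h.perim ≤ e.perim := by omega
    by_contra hcon
    have : h.perim ≤ e.perim - 1 := by omega
    nlinarith
  rw [hperim] at harea_h hmod_h
  -- With equal perimeters, `6 * (#h.faces - #P)` is a difference of deficits, at most `7`; so the
  -- areas differ by at most one and, having equal parity, agree.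
  have hcard' : #h.faces = #P := by omega
  have heq : P = h.faces := eq_of_subset_of_card_le hPh hcard'.le
  rw [heq] at hne
  refine hne (isQuasiRegularHexagon_of_deficit_le (hperim ▸ hp) ?_)
  rw [hcard', hA] at harea_h
  omega

end Polyiamond

theorem mainTheorem10 (E P : Finset Polyiamond.Face)
    (hE : Polyiamond.IsQuasiRegularHexagon E)
    (hP : Polyiamond.IsPolyiamond P)
    (hPE : ¬ Polyiamond.IsQuasiRegularHexagon P)
    (hA : Polyiamond.area P = Polyiamond.area E) :
    Polyiamond.edgePerimeter E + 2 ≤ Polyiamond.edgePerimeter P := by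
  obtain ⟨e, rfl, he, hp, hd⟩ := hE.exists_bounds
  have h1 := hP.perim_add_two_le he hp hd hA hPE
  have h2 : (Polyiamond.edgePerimeter e.faces : ℤ) ≤ e.perim := by
    obtain ⟨h1, h2, h3, h4, h5, h6⟩ := he
    exact Polyiamond.HexBounds.edgePerimeter_faces_le (by omega) (by omega) (by omega)
  omega
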